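/- Structural Lemma. For a Borel probability measure $\nu$ on a Euclidean $d$-space $V$ (a $d$-dimensional real inner product space) and $x\in V$ let $$\operatorname{depth}_\nu(x)=\inf\{\nu(H): H\subset V \text{ a closed half-space},\ x\in H\}.$$ A point $o\in V$ is a Tukey median of $\nu$ if $\operatorname{depth}_\nu(o)=\sup_{x\in V}\operatorname{depth}_\nu(x)$. The measure $\nu$ is called nice if it has a density $f_\nu:V\to\mathbb R$ that is continuous, satisfies $f_\nu(x)>0$ for all $x\in V$, and for which there are $C_1,C_2>0$ with $f_\nu(x)<C_1e^{-C_2\|x\|}$ for all $x\in V$. The set of nice measures on $V$ carries the metric $\|\nu-\nu'\|=\int_V|f_\nu(x)-f_{\nu'}(x)|\,dx$. Let $\mathcal M_a^\circ(V)$ be the subspace of those nice measures $\nu$ on $V$ for which $\sup_{x\in V}\operatorname{depth}_\nu(x)<a$ and the origin is a Tukey median. Let $\mathcal T(V)$ be the set of all unordered $(d+1)$-tuples $\{e_1,\dots,e_{d+1}\}$ of vectors $e_i\in V$ such that $\dim\operatorname{conv}\{e_1,\dots,e_{d+1}\}=d$ and $\mathbf 0\in\operatorname{relint}\operatorname{conv}\{e_1,\dots,e_{d+1}\}$,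 with the topology induced from the quotient space $V^{d+1}/\mathfrak S_{d+1}$. Put $a_0=\frac1{d+1}+\frac1{3(d+1)^3}$ and let $a\in\left(\frac1{d+1},a_0\right)$. Then for every Euclidean $d$-space $V$ one can define a map $T^V_a:\mathcal M_a^\circ(V)\to\mathcal T(V)$ such that 1. $T^V_a$ is continuous for every $V$; 2. for any two Euclidean $d$-spaces $V_1,V_2$ and any linear isometry $F:V_1\to V_2$ one has $T^{V_2}_a(F_*\nu)=F\bigl(T^{V_1}_a(\nu)\bigr)$ for every $\nu\in\mathcal M_a^\circ(V_1)$, where $F_*\nu$ is the push-forward measure and $F(\{e_1,\dots,e_{d+1}\})=\{F(e_1),\dots,F(e_{d+1})\}$. -/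

import Mathlib

open MeasureTheory

universe u

noncomputable section

namespace TukeyDepth

/-! ### Half-spaces and depth -/

/-- Closed half-spaces `{y | ⟪n, y⟫ ≤ c}`, with `n ≠ 0`. -/
def IsClosedHalfSpace {V : Type*} [NormedAddCommGroup V] [InnerProductSpace ℝ V]
    (H : Set V) : Prop :=
  ∃ n : V, n ≠ 0 ∧ ∃ c : ℝ, H = {y | inner ℝ n y ≤ c}

/-- The half-space (Tukey) depth of a point: the infimum of the masses of the closed half-spaces
that contain the point. -/
def depth {V : Type*} [NormedAddCommGroup V] [InnerProductSpace ℝ V] [MeasurableSpace V]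
    (μ : Measure V) (x : V) : ℝ :=
  sInf ((fun H : Set V => μ.real H) '' {H | IsClosedHalfSpace H ∧ x ∈ H})

/-- A Tukey median is a point of maximal depth. -/
def IsTukeyMedian {V : Type*} [NormedAddCommGroup V] [InnerProductSpace ℝ V] [MeasurableSpace V]
    (μ : Measure V) (o : V) : Prop :=
  depth μ o = ⨆ x : V, depth μ x

theorem IsClosedHalfSpace.preimage {V₁ V₂ : Type*}
    [NormedAddCommGroup V₁] [InnerProductSpace ℝ V₁]
    [NormedAddCommGroup V₂] [InnerProductSpace ℝ V₂]
    (F : V₁ ≃ₗᵢ[ℝ] V₂) {H : Set V₂} (hH : IsClosedHalfSpace H) :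
    IsClosedHalfSpace (F ⁻¹' H) := by
  obtain ⟨n, hn, c, rfl⟩ := hH
  refine ⟨F.symm n, by simpa using hn, c, ?_⟩
  ext y
  have h : inner ℝ (F.symm n) y = inner ℝ n (F y) := by
    rw [← F.inner_map_map, F.apply_symm_apply]
  simp [h]

theorem IsClosedHalfSpace.measurableSet {V : Type*} [NormedAddCommGroup V]
    [InnerProductSpace ℝ V] [MeasurableSpace V] [BorelSpace V] {H : Set V}
    (hH : IsClosedHalfSpace H) : MeasurableSet H := by
  obtain ⟨n, -, c, rfl⟩ := hH
  exact (isClosed_le (by fun_prop) continuous_const).measurableSet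

theorem depth_map {V₁ V₂ : Type*}
    [NormedAddCommGroup V₁] [InnerProductSpace ℝ V₁] [MeasurableSpace V₁] [BorelSpace V₁]
    [NormedAddCommGroup V₂] [InnerProductSpace ℝ V₂] [MeasurableSpace V₂] [BorelSpace V₂]
    (F : V₁ ≃ₗᵢ[ℝ] V₂) (μ : Measure V₁) (x : V₁) :
    depth (μ.map F) (F x) = depth μ x := by
  unfold depth
  congr 1
  ext t
  constructor
  · rintro ⟨H, ⟨hH, hx⟩, rfl⟩
    exact ⟨F ⁻¹' H, ⟨hH.preimage F, hx⟩,
      (map_measureReal_apply F.continuous.measurable hH.measurableSet).symm⟩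
  · rintro ⟨H, ⟨hH, hx⟩, rfl⟩
    have hH' : IsClosedHalfSpace (F.symm ⁻¹' H) := hH.preimage F.symm
    refine ⟨F.symm ⁻¹' H, ⟨hH', by simpa using hx⟩, ?_⟩
    have h : F ⁻¹' (F.symm ⁻¹' H) = H := by ext y; simp
    simp only
    rw [map_measureReal_apply F.continuous.measurable hH'.measurableSet, h]

theorem iSup_depth_map {V₁ V₂ : Type*}
    [NormedAddCommGroup V₁] [InnerProductSpace ℝ V₁] [MeasurableSpace V₁] [BorelSpace V₁]
    [NormedAddCommGroup V₂] [InnerProductSpace ℝ V₂] [MeasurableSpace V₂] [BorelSpace V₂]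
    (F : V₁ ≃ₗᵢ[ℝ] V₂) (μ : Measure V₁) :
    (⨆ y : V₂, depth (μ.map F) y) = ⨆ x : V₁, depth μ x := by
  rw [← F.surjective.iSup_comp (fun y => depth (μ.map F) y)]
  simp only [depth_map]

/-! ### Nice measures -/

/-- A nice measure: a Borel probability measure that has a continuous, everywhere positive and
exponentially decaying density with respect to Lebesgue measure. The density is determined by the
measure, see `NiceMeasure.ext_toMeasure`. -/
structure NiceMeasure (V : Type*) [NormedAddCommGroup V] [InnerProductSpace ℝ V]
    [FiniteDimensional ℝ V] [MeasurableSpace V] [BorelSpace V] where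
  toMeasure : Measure V
  isProbabilityMeasure : IsProbabilityMeasure toMeasure
  density : V → ℝ
  toMeasure_eq : toMeasure = volume.withDensity (fun x => ENNReal.ofReal (density x))
  continuous_density : Continuous density
  density_pos : ∀ x, 0 < density x
  density_decay : ∃ C₁ > 0, ∃ C₂ > 0, ∀ x, density x < C₁ * Real.exp (-C₂ * ‖x‖)

namespace NiceMeasure

section

variable {V : Type*} [NormedAddCommGroup V] [InnerProductSpace ℝ V]
  [FiniteDimensional ℝ V] [MeasurableSpace V] [BorelSpace V]

theorem ext_density {μ ν : NiceMeasure V} (h : μ.density = ν.density) : μ = ν := by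
  have h' : μ.toMeasure = ν.toMeasure := by rw [μ.toMeasure_eq, ν.toMeasure_eq, h]
  cases μ; cases ν
  simp only at h h'
  subst h h'
  rfl

theorem integrable_density (μ : NiceMeasure V) : Integrable μ.density := by
  refine ⟨μ.continuous_density.aestronglyMeasurable, ?_⟩
  have h1 : ∫⁻ x, ENNReal.ofReal (μ.density x) = 1 := by
    have := μ.isProbabilityMeasure.measure_univ
    rwa [μ.toMeasure_eq, withDensity_apply _ MeasurableSet.univ, Measure.restrict_univ] at this
  rw [hasFiniteIntegral_iff_ofReal (Filter.Eventually.of_forall fun x => (μ.density_pos x).le), h1]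
  exact ENNReal.one_lt_top

/-- A nice measure is determined by its underlying measure: the continuous density is unique. -/
theorem ext_toMeasure {μ ν : NiceMeasure V} (h : μ.toMeasure = ν.toMeasure) : μ = ν := by
  apply ext_density
  rw [μ.toMeasure_eq, ν.toMeasure_eq, withDensity_eq_iff_of_sigmaFinite
    μ.continuous_density.measurable.ennreal_ofReal.aemeasurable
    ν.continuous_density.measurable.ennreal_ofReal.aemeasurable] at h
  refine (μ.continuous_density.ae_eq_iff_eq volume ν.continuous_density).1 ?_
  filter_upwards [h] with x hx
  exact (ENNReal.ofReal_eq_ofReal_iff (μ.density_pos x).le (ν.density_pos x).le).1 hx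

/-- The metric on nice measures: the `L¹` distance between the densities. -/
instance : MetricSpace (NiceMeasure V) where
  dist μ ν := ∫ x, |μ.density x - ν.density x|
  dist_self μ := by simp
  dist_comm μ ν := by simp only [abs_sub_comm]
  dist_triangle μ ν ρ := by
    have hμν := (μ.integrable_density.sub ν.integrable_density).abs
    have hνρ := (ν.integrable_density.sub ρ.integrable_density).abs
    have hμρ := (μ.integrable_density.sub ρ.integrable_density).abs
    calc ∫ x, |μ.density x - ρ.density x|
        ≤ ∫ x, (|μ.density x - ν.density x| + |ν.density x - ρ.density x|) :=
          integral_mono hμρ (hμν.add hνρ) fun x => abs_sub_le _ _ _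
      _ = _ := integral_add hμν hνρ
  eq_of_dist_eq_zero {μ ν} h := by
    have hi := (μ.integrable_density.sub ν.integrable_density).abs
    have h0 := (integral_eq_zero_iff_of_nonneg (fun x => abs_nonneg _) hi).1 h
    refine ext_density ((μ.continuous_density.ae_eq_iff_eq volume ν.continuous_density).1 ?_)
    filter_upwards [h0] with x hx
    exact sub_eq_zero.1 (abs_eq_zero.1 hx)

end

/-- The nice measures whose maximal depth is less than `a`. -/
def depthLT (V : Type*) [NormedAddCommGroup V] [InnerProductSpace ℝ V]
    [FiniteDimensional ℝ V] [MeasurableSpace V] [BorelSpace V] (a : ℝ) : Set (NiceMeasure V) :=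
  {ν | (⨆ x : V, depth ν.toMeasure x) < a}

/-- The nice measures whose maximal depth is less than `a` and for which the origin is a Tukey
median. -/
def centred (V : Type*) [NormedAddCommGroup V] [InnerProductSpace ℝ V]
    [FiniteDimensional ℝ V] [MeasurableSpace V] [BorelSpace V] (a : ℝ) : Set (NiceMeasure V) :=
  {ν | ν ∈ depthLT V a ∧ IsTukeyMedian ν.toMeasure 0}

section

variable {V₁ V₂ : Type*}
  [NormedAddCommGroup V₁] [InnerProductSpace ℝ V₁] [FiniteDimensional ℝ V₁]
  [MeasurableSpace V₁] [BorelSpace V₁]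
  [NormedAddCommGroup V₂] [InnerProductSpace ℝ V₂] [FiniteDimensional ℝ V₂]
  [MeasurableSpace V₂] [BorelSpace V₂]

/-- The push-forward of a nice measure under a linear isometry. -/
def map (F : V₁ ≃ₗᵢ[ℝ] V₂) (ν : NiceMeasure V₁) : NiceMeasure V₂ where
  toMeasure := ν.toMeasure.map F
  isProbabilityMeasure :=
    have := ν.isProbabilityMeasure
    Measure.isProbabilityMeasure_map F.continuous.measurable.aemeasurable
  density := fun y => ν.density (F.symm y)
  toMeasure_eq := by
    ext s hs
    rw [Measure.map_apply F.continuous.measurable hs, ν.toMeasure_eq,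
      withDensity_apply _ (F.continuous.measurable hs), withDensity_apply _ hs,
      ← F.measurePreserving.setLIntegral_comp_preimage hs
        (f := fun y => ENNReal.ofReal (ν.density (F.symm y)))
        (ν.continuous_density.comp F.symm.continuous).measurable.ennreal_ofReal]
    simp
  continuous_density := ν.continuous_density.comp F.symm.continuous
  density_pos := fun y => ν.density_pos _
  density_decay := by
    obtain ⟨C₁, h₁, C₂, h₂, h⟩ := ν.density_decay
    exact ⟨C₁, h₁, C₂, h₂, fun y => by simpa using h (F.symm y)⟩

/-- The push-forward map `F_*` on the nice measures of maximal depth less than `a` that have the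
origin as a Tukey median. -/
def mapCentred (a : ℝ) (F : V₁ ≃ₗᵢ[ℝ] V₂) (ν : centred V₁ a) : centred V₂ a :=
  ⟨map F ν.1, by
    obtain ⟨ν, h1, h2⟩ := ν
    have e1 : (⨆ y : V₂, depth (map F ν).toMeasure y) = ⨆ x : V₁, depth ν.toMeasure x :=
      iSup_depth_map F ν.toMeasure
    have e2 : depth (map F ν).toMeasure 0 = depth ν.toMeasure 0 := by
      have := depth_map F ν.toMeasure 0
      rwa [map_zero] at this
    refine ⟨?_, ?_⟩
    · change (⨆ y : V₂, depth (map F ν).toMeasure y) < a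
      rw [e1]
      exact h1
    · change depth (map F ν).toMeasure 0 = _
      rw [e1, e2]
      exact h2⟩

end

end NiceMeasure

/-! ### Unordered tuples of vectors -/

/-- Two ordered `k`-tuples are equivalent if they differ by a permutation of the indices. -/
def permSetoid (V : Type*) (k : ℕ) : Setoid (Fin k → V) where
  r e e' := ∃ σ : Equiv.Perm (Fin k), e' = e ∘ σ
  iseqv :=
    { refl := fun e => ⟨1, rfl⟩
      symm := by
        rintro e e' ⟨σ, rfl⟩
        exact ⟨σ⁻¹, by ext i; simp⟩
      trans := by
        rintro e e' e'' ⟨σ, rfl⟩ ⟨τ, rfl⟩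
        exact ⟨σ * τ, by ext i; simp⟩ }

/-- The space `V ^ k / 𝔖_k` of unordered `k`-tuples. -/
def UnorderedTuple (V : Type*) (k : ℕ) : Type _ := Quotient (permSetoid V k)

/-- The quotient topology of the product topology. -/
instance (V : Type*) [TopologicalSpace V] (k : ℕ) : TopologicalSpace (UnorderedTuple V k) :=
  inferInstanceAs (TopologicalSpace (Quotient (permSetoid V k)))

/-- The unordered tuple of the entries of an ordered tuple. -/
def UnorderedTuple.mk {V : Type*} {k : ℕ} (e : Fin k → V) : UnorderedTuple V k :=
  Quotient.mk (permSetoid V k) e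

/-- The map `{e₁, …, e_k} ↦ {F e₁, …, F e_k}`. -/
def UnorderedTuple.map {V₁ V₂ : Type*} {k : ℕ} (F : V₁ → V₂) :
    UnorderedTuple V₁ k → UnorderedTuple V₂ k :=
  Quotient.map (fun e => F ∘ e) (by
    rintro e e' ⟨σ, rfl⟩
    exact ⟨σ, rfl⟩)

/-- The set of unordered `(d + 1)`-tuples of vectors whose convex hull has dimension `d` and
contains the origin in its relative interior. (The dimension of a convex set is the dimension of
the direction of its affine span; neither condition depends on the order of the entries.) -/
def simplexTuples (V : Type*) [NormedAddCommGroup V] [InnerProductSpace ℝ V] (d : ℕ) :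
    Set (UnorderedTuple V (d + 1)) :=
  {q | ∃ e : Fin (d + 1) → V, q = UnorderedTuple.mk e ∧
    Module.finrank ℝ (affineSpan ℝ (convexHull ℝ (Set.range e))).direction = d ∧
    (0 : V) ∈ intrinsicInterior ℝ (convexHull ℝ (Set.range e))}

/-- The map induced on simplex tuples by a linear isometry. -/
def simplexTuplesMap {V₁ V₂ : Type*}
    [NormedAddCommGroup V₁] [InnerProductSpace ℝ V₁]
    [NormedAddCommGroup V₂] [InnerProductSpace ℝ V₂]
    (d : ℕ) (F : V₁ ≃ₗᵢ[ℝ] V₂) (q : simplexTuples V₁ d) : simplexTuples V₂ d :=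
  ⟨UnorderedTuple.map F q.1, by
    obtain ⟨q, e, rfl, hdim, h0⟩ := q
    have himg : convexHull ℝ (Set.range (F ∘ e)) = F '' convexHull ℝ (Set.range e) := by
      rw [Set.range_comp]
      exact (F.toLinearEquiv.toLinearMap.image_convexHull (Set.range e)).symm
    refine ⟨F ∘ e, rfl, ?_, ?_⟩
    · have h := AffineMap.map_vectorSpan
        F.toLinearEquiv.toLinearMap.toAffineMap (s := convexHull ℝ (Set.range e))
      have h' : vectorSpan ℝ (F '' convexHull ℝ (Set.range e)) =
          (vectorSpan ℝ (convexHull ℝ (Set.range e))).map F.toLinearEquiv.toLinearMap := h.symm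
      rw [himg, direction_affineSpan, h',
        LinearEquiv.finrank_map_eq F.toLinearEquiv (vectorSpan ℝ (convexHull ℝ (Set.range e)))]
      rwa [direction_affineSpan] at hdim
    · rw [himg]
      have h := F.toLinearIsometry.toAffineIsometry.intrinsicInterior_image
        (convexHull ℝ (Set.range e))
      have h' : intrinsicInterior ℝ (F '' convexHull ℝ (Set.range e)) =
          F '' intrinsicInterior ℝ (convexHull ℝ (Set.range e)) := h
      rw [h']
      exact ⟨0, h0, map_zero F⟩⟩

/-- The constant `a₀ = 1 / (d + 1) + 1 / (3 (d + 1)³)`. -/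
def a₀ (d : ℕ) : ℝ := 1 / ((d : ℝ) + 1) + 1 / (3 * ((d : ℝ) + 1) ^ 3)

end TukeyDepth

end

/-! Call `n` light if the half-space through the origin with outer normal `n` has mass below `a`. If
the origin were outside the convex hull of the light normals, moving the median slightly in a
suitable direction would increase its depth; so the hull contains it
(`NiceMeasure.zero_mem_convexHull_light`). Carathéodory's theorem and a mass count then give exactly
`d + 1` positively spanning light normals, a frame.

A frame is not unique, but its ambiguity is controlled. Its half-spaces cover `V` with total mass
barely above 1, so any two light half-spaces overlap either in mass at most `(d + 1) a - 1` or in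
mass at least `1 - d a` (`overlap_le_of_not_close`). The bound on `a` makes the second alternative
an equivalence relation on light normals (`Close.trans`), with one class for each member of a frame
(`IsFrame.exists_perm`).

The map sends a measure to the weighted means of these classes, the axes. They do not depend on the
frame, up to order (`mk_axis_eq`). They positively span, since frame members can be replaced by
means one at a time (`IsFrame.posSpanning_axis`). For a fixed normal the axis varies continuously
with the measure, and a frame remains a frame for nearby measures; this gives continuity. The
construction uses only Euclidean structure, hence equivariance. -/

noncomputable section

namespace TukeyDepth

/-! ### Positively spanning families -/

section PosSpanning

variable {V : Type*} [NormedAddCommGroup V] [InnerProductSpace ℝ V]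

/-- A family of vectors positively spans if no nonzero vector has nonpositive inner product with
all of its members. -/
def PosSpanning {ι : Type*} (m : ι → V) : Prop :=
  ∀ v : V, v ≠ 0 → ∃ i, 0 < inner ℝ (m i) v

theorem PosSpanning.of_range_subset {ι κ : Type*} {m : ι → V} {m' : κ → V} (h : PosSpanning m)
    (hs : Set.range m ⊆ Set.range m') : PosSpanning m' := by
  intro v hv
  obtain ⟨i, hi⟩ := h v hv
  obtain ⟨j, hj⟩ := hs ⟨i, rfl⟩
  exact ⟨j, by rwa [hj]⟩

theorem PosSpanning.exists_inner_nonpos {ι : Type*} [Nonempty ι] {m : ι → V}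
    (h : PosSpanning m) (y : V) : ∃ i, inner ℝ (m i) y ≤ 0 := by
  by_cases hy : y = 0
  · exact ⟨Classical.arbitrary ι, by simp [hy]⟩
  · obtain ⟨i, hi⟩ := h (-y) (neg_ne_zero.2 hy)
    exact ⟨i, by rw [inner_neg_right] at hi; linarith⟩

variable [FiniteDimensional ℝ V]

omit [FiniteDimensional ℝ V] in
theorem eq_zero_of_span_eq_top {s : Set V} (hs : Submodule.span ℝ s = ⊤) {v : V}
    (hv : ∀ x ∈ s, inner ℝ x v = 0) : v = 0 := by
  have h : Submodule.span ℝ s ≤ (LinearMap.ker (innerSL ℝ v).toLinearMap) :=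
    Submodule.span_le.2 fun x hx => by
      simpa [real_inner_comm] using hv x hx
  rw [hs] at h
  simpa using h (Submodule.mem_top : v ∈ ⊤)

theorem exists_ne_zero_inner_eq_zero {s : Set V} (hs : Submodule.span ℝ s ≠ ⊤) :
    ∃ v : V, v ≠ 0 ∧ ∀ x ∈ s, inner ℝ x v = 0 := by
  obtain ⟨v, hv, hv0⟩ := Submodule.exists_mem_ne_zero_of_ne_bot
    (mt (Submodule.orthogonal_eq_bot_iff).1 hs)
  exact ⟨v, hv0, fun x hx => hv x (Submodule.subset_span hx)⟩

theorem PosSpanning.span_eq_top {ι : Type*} {m : ι → V} (h : PosSpanning m) :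
    Submodule.span ℝ (Set.range m) = ⊤ := by
  by_contra hs
  obtain ⟨v, hv, h0⟩ := exists_ne_zero_inner_eq_zero hs
  obtain ⟨i, hi⟩ := h v hv
  exact hi.ne' (h0 _ ⟨i, rfl⟩)

theorem PosSpanning.zero_mem_convexHull {ι : Type*} [Finite ι] [Nonempty ι] {m : ι → V}
    (h : PosSpanning m) : (0 : V) ∈ convexHull ℝ (Set.range m) := by
  by_contra h0
  obtain ⟨f, u, hu, hf⟩ := geometric_hahn_banach_point_closed (convex_convexHull ℝ (Set.range m))
    ((Set.finite_range m).isClosed_convexHull ℝ) h0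
  obtain ⟨i, hi⟩ := h.exists_inner_nonpos ((InnerProductSpace.toDual ℝ V).symm f)
  have h1 := hf (m i) (subset_convexHull ℝ _ ⟨i, rfl⟩)
  rw [real_inner_comm, InnerProductSpace.toDual_symm_apply] at hi
  rw [map_zero] at hu
  linarith

variable {d : ℕ}

/-- Any `d` members of a positively spanning family of `d + 1` vectors are linearly independent. -/
theorem PosSpanning.linearIndependent_succAbove (hV : Module.finrank ℝ V = d)
    {m : Fin (d + 1) → V} (h : PosSpanning m) (i : Fin (d + 1)) :
    LinearIndependent ℝ (fun j : Fin d => m (i.succAbove j)) := by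
  refine linearIndependent_of_top_le_span_of_card_eq_finrank (top_le_iff.2 ?_) (by simp [hV])
  by_contra hs
  obtain ⟨v, hv, h0⟩ := exists_ne_zero_inner_eq_zero hs
  -- A nonzero vector orthogonal to the other `d` members must have positive product with the
  -- remaining one. This cannot hold for both `v` and `-v`.
  have key : ∀ w : V, w ≠ 0 → (∀ j, inner ℝ (m (i.succAbove j)) w = 0) →
      0 < inner ℝ (m i) w := by
    intro w hw hw0
    obtain ⟨k, hk⟩ := h w hw
    rcases Fin.eq_self_or_eq_succAbove i k with rfl | ⟨j, rfl⟩
    · exact hk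
    · exact absurd (hw0 j) hk.ne'
  have h1 := key v hv fun j => h0 _ ⟨j, rfl⟩
  have h2 := key (-v) (neg_ne_zero.2 hv) fun j => by
    rw [inner_neg_right, h0 _ ⟨j, rfl⟩, neg_zero]
  rw [inner_neg_right] at h2
  linarith

/-- The origin lies in the convex hull; a vanishing weight would leave a nontrivial relation among
`d` linearly independent members. -/
theorem PosSpanning.exists_pos_weights (hV : Module.finrank ℝ V = d) {m : Fin (d + 1) → V}
    (h : PosSpanning m) :
    ∃ b : Fin (d + 1) → ℝ, (∀ i, 0 < b i) ∧ ∑ i, b i = 1 ∧ ∑ i, b i • m i = 0 := by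
  have h0 := h.zero_mem_convexHull
  rw [convexHull_range_eq_exists_affineCombination] at h0
  obtain ⟨s, w, hw0, hw1, hw⟩ := h0
  rw [s.affineCombination_eq_linear_combination _ _ hw1] at hw
  set b : Fin (d + 1) → ℝ := fun i => if i ∈ s then w i else 0 with hb
  have hb0 : ∀ i, 0 ≤ b i := fun i => by
    by_cases hi : i ∈ s
    · simpa [hb, hi] using hw0 i hi
    · simp [hb, hi]
  have hb1 : ∑ i, b i = 1 := by simpa [hb] using hw1
  have hbm : ∑ i, b i • m i = 0 := by simpa [hb, ite_smul] using hw
  refine ⟨b, fun i => (hb0 i).lt_of_ne fun hi => ?_, hb1, hbm⟩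
  rw [Fin.sum_univ_succAbove _ i, ← hi, zero_smul, zero_add] at hbm
  have hz := Fintype.linearIndependent_iff.1 (h.linearIndependent_succAbove hV i) _ hbm
  rw [Fin.sum_univ_succAbove _ i, ← hi] at hb1
  simp [hz] at hb1

theorem PosSpanning.affineSpan_eq_top {ι : Type*} [Finite ι] [Nonempty ι] {m : ι → V}
    (h : PosSpanning m) : affineSpan ℝ (Set.range m) = ⊤ := by
  have h0 : (0 : V) ∈ affineSpan ℝ (Set.range m) :=
    convexHull_subset_affineSpan _ h.zero_mem_convexHull
  rw [AffineSubspace.affineSpan_eq_top_iff_vectorSpan_eq_top_of_nonempty ℝ V V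
    (Set.range_nonempty m), ← direction_affineSpan, ← top_le_iff, ← h.span_eq_top,
    Submodule.span_le]
  intro x hx
  simpa using AffineSubspace.vsub_mem_direction (subset_affineSpan ℝ _ hx) h0

/-- The positive weights are the barycentric coordinates of the origin, which is therefore interior
to the simplex. -/
theorem PosSpanning.mk_mem_simplexTuples (hV : Module.finrank ℝ V = d) {m : Fin (d + 1) → V}
    (h : PosSpanning m) : UnorderedTuple.mk m ∈ simplexTuples V d := by
  have htop := h.affineSpan_eq_top
  refine ⟨m, rfl, ?_, ?_⟩
  · rw [affineSpan_convexHull, htop, AffineSubspace.direction_top, finrank_top, hV]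
  · refine interior_subset_intrinsicInterior ?_
    have hai : AffineIndependent ℝ m := by
      rw [affineIndependent_iff_finrank_vectorSpan_eq ℝ m (n := d) (by simp),
        ← direction_affineSpan, htop, AffineSubspace.direction_top, finrank_top, hV]
    obtain ⟨b, hb, hb1, hbm⟩ := h.exists_pos_weights hV
    let B : AffineBasis (Fin (d + 1)) ℝ V := ⟨m, hai, htop⟩
    have hB : (0 : V) = Finset.univ.affineCombination ℝ B b := by
      rw [Finset.affineCombination_eq_linear_combination _ _ _ hb1]
      exact hbm.symm
    change (0 : V) ∈ interior (convexHull ℝ (Set.range B))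
    rw [B.interior_convexHull, hB]
    intro i
    rw [B.coord_apply_combination_of_mem (Finset.mem_univ i) hb1]
    exact hb i

/-- If all products with `v` were nonpositive, pairing the relation with `v` would force them all to
vanish, although the family spans. -/
theorem AffineIndependent.posSpanning (hV : Module.finrank ℝ V = d) {m : Fin (d + 1) → V}
    (h : AffineIndependent ℝ m) {w : Fin (d + 1) → ℝ} (hw : ∀ i, 0 < w i)
    (hwm : ∑ i, w i • m i = 0) : PosSpanning m := by
  intro v hv
  by_contra! hle
  have hsum : ∑ i, w i * inner ℝ (m i) v = 0 := by
    have := congrArg (fun x => inner ℝ x v) hwm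
    simpa [sum_inner, inner_smul_left] using this
  have hz := (Finset.sum_eq_zero_iff_of_nonpos
    fun i _ => mul_nonpos_of_nonneg_of_nonpos (hw i).le (hle i)).1 hsum
  refine hv (eq_zero_of_span_eq_top (s := Set.range m) ?_ ?_)
  · have htop := h.affineSpan_eq_top_iff_card_eq_finrank_add_one.2 (by simp [hV])
    rw [← top_le_iff]
    intro x _
    exact affineSpan_subset_span (htop ▸ AffineSubspace.mem_top ℝ V x)
  · rintro _ ⟨i, rfl⟩
    exact (mul_eq_zero.1 (hz i (Finset.mem_univ i))).resolve_left (hw i).ne'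

omit [FiniteDimensional ℝ V] in
theorem zero_mem_convexHull_of_sum_eq_zero {ι : Type*} [Fintype ι] {m : ι → V} {w : ι → ℝ}
    (hw : ∀ i, 0 ≤ w i) {k : ι} (hk : 0 < w k) (hwm : ∑ i, w i • m i = 0) :
    (0 : V) ∈ convexHull ℝ (Set.range m) := by
  have h := Finset.univ.centerMass_mem_convexHull (R := ℝ) (w := w) (z := m)
    (s := Set.range m) (fun i _ => hw i)
    (Finset.sum_pos' (fun i _ => hw i) ⟨k, Finset.mem_univ k, hk⟩) fun i _ => ⟨i, rfl⟩
  rwa [Finset.centerMass, hwm, smul_zero] at h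

/-- The exchange step of the simplex method. -/
theorem PosSpanning.exists_zero_mem_convexHull_update (hV : Module.finrank ℝ V = d)
    {m : Fin (d + 1) → V} (h : PosSpanning m) (n : V) :
    ∃ i, (0 : V) ∈ convexHull ℝ (Set.range (Function.update m i n)) := by
  obtain ⟨b, hb, -, hbm⟩ := h.exists_pos_weights hV
  have hn : n ∈ Submodule.span ℝ (Set.range m) := h.span_eq_top ▸ Submodule.mem_top
  obtain ⟨c, hc⟩ := (Submodule.mem_span_range_iff_exists_fun ℝ).1 hn
  -- Ratio test: subtracting `n = ∑ c j • m j` from the largest ratio times the relation `∑ b j • m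
  -- j = 0` keeps all coefficients nonnegative and cancels the one at `i`.
  obtain ⟨i, hi⟩ := Finite.exists_max fun j => c j / b j
  set l : Fin (d + 1) → ℝ := fun j => b j * (c i / b i) - c j with hl
  have hl0 : ∀ j, 0 ≤ l j := fun j => by
    have := (div_le_iff₀' (hb j)).1 (hi j)
    simp only [hl]
    linarith
  have hli : l i = 0 := by
    simp only [hl]
    rw [mul_div_cancel₀ _ (hb i).ne', sub_self]
  have hsum : ∑ j, l j • m j = -n := by
    simp only [hl, sub_smul, Finset.sum_sub_distrib, hc]
    have : ∀ j, (b j * (c i / b i)) • m j = (c i / b i) • b j • m j := fun j => by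
      rw [smul_smul, mul_comm]
    rw [Finset.sum_congr rfl fun j _ => this j, ← Finset.smul_sum, hbm, smul_zero, zero_sub]
  refine ⟨i, zero_mem_convexHull_of_sum_eq_zero (w := Function.update l i 1) (k := i) ?_
    (by simp) ?_⟩
  · intro j
    rcases eq_or_ne j i with rfl | hj
    · simp
    · simpa [hj] using hl0 j
  · rw [Fin.sum_univ_succAbove _ i] at hsum ⊢
    rw [hli, zero_smul, zero_add] at hsum
    simp [hsum]

end PosSpanning

/-! ### Light half-spaces -/

section Light

variable {V : Type*} [NormedAddCommGroup V] [InnerProductSpace ℝ V]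

/-- The half-space with outer normal `n` and the origin on its boundary. -/
def halfSpace (n : V) : Set V := {y | inner ℝ n y ≤ 0}

variable [MeasurableSpace V]

/-- The outer normals of the half-spaces through the origin that have mass less than `a`. -/
def light (μ : Measure V) (a : ℝ) : Set V := {n | μ.real (halfSpace n) < a}

/-- A frame consists of positively spanning normals of light half-spaces. -/
def IsFrame {d : ℕ} (μ : Measure V) (a : ℝ) (m : Fin (d + 1) → V) : Prop :=
  PosSpanning m ∧ ∀ i, m i ∈ light μ a

variable [BorelSpace V]

theorem measurableSet_halfSpace (n : V) : MeasurableSet (halfSpace n) :=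
  (isClosed_le (by fun_prop) continuous_const).measurableSet

omit [BorelSpace V] in
theorem one_le_sum_of_cover {ι : Type*} [Fintype ι] (μ : Measure V) [IsProbabilityMeasure μ]
    {m : ι → V} (h : ∀ y, ∃ i, inner ℝ (m i) y ≤ 0) : 1 ≤ ∑ i, μ.real (halfSpace (m i)) := by
  have hU : ⋃ i, halfSpace (m i) = Set.univ := Set.iUnion_eq_univ_iff.2 h
  calc (1 : ℝ) = μ.real (⋃ i, halfSpace (m i)) := by rw [hU, probReal_univ]
    _ ≤ _ := measureReal_iUnion_fintype_le _

variable {d : ℕ} {μ : Measure V} [IsProbabilityMeasure μ] {a : ℝ}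

/-- The half-spaces of a frame cover `V`, so anything counted twice is part of the excess of their
total mass over 1. -/
theorem IsFrame.overlap_le {m : Fin (d + 1) → V} (h : IsFrame μ a m) {i j : Fin (d + 1)}
    (hij : i ≠ j) :
    μ.real (halfSpace (m i) ∩ halfSpace (m j)) ≤ ((d : ℝ) + 1) * a - 1 := by
  have hcover : Set.univ ⊆ (halfSpace (m i) ∪ halfSpace (m j)) ∪
      ⋃ k ∈ (Finset.univ.erase i).erase j, halfSpace (m k) := by
    intro y _
    obtain ⟨k, hk⟩ := h.1.exists_inner_nonpos y
    by_cases hki : k = i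
    · exact Or.inl (Or.inl (hki ▸ hk))
    by_cases hkj : k = j
    · exact Or.inl (Or.inr (hkj ▸ hk))
    · exact Or.inr (Set.mem_biUnion (by simp [hki, hkj]) hk)
  have h1 : (1 : ℝ) ≤ μ.real (halfSpace (m i) ∪ halfSpace (m j)) +
      ∑ k ∈ (Finset.univ.erase i).erase j, μ.real (halfSpace (m k)) := by
    calc (1 : ℝ) = μ.real Set.univ := probReal_univ.symm
      _ ≤ _ := measureReal_mono hcover
      _ ≤ _ := measureReal_union_le _ _
      _ ≤ _ := by gcongr; exact measureReal_biUnion_finset_le _ _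
  have h2 := measureReal_union_add_inter (μ := μ) (s := halfSpace (m i))
    (measurableSet_halfSpace (m j))
  have h3 : ∑ k, μ.real (halfSpace (m k)) ≤ ((d : ℝ) + 1) * a := by
    calc _ ≤ ∑ k : Fin (d + 1), a := Finset.sum_le_sum fun k _ => (h.2 k).le
      _ = _ := by simp
  rw [← Finset.add_sum_erase _ _ (Finset.mem_univ i),
    ← Finset.add_sum_erase _ _ (Finset.mem_erase.2 ⟨hij.symm, Finset.mem_univ j⟩)] at h3
  linarith

-- Both families cover `V`, so a point outside the `d` shared half-spaces lies in both exchanged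
-- ones. Such points have mass at least `1 - d a`.
omit [BorelSpace V] in
theorem le_overlap_of_update {m : Fin (d + 1) → V} (h : IsFrame μ a m) {i : Fin (d + 1)} {n : V}
    (hn : PosSpanning (Function.update m i n)) :
    1 - d * a ≤ μ.real (halfSpace n ∩ halfSpace (m i)) := by
  have hcover : Set.univ ⊆ (halfSpace n ∩ halfSpace (m i)) ∪
      ⋃ j : Fin d, halfSpace (m (i.succAbove j)) := by
    intro y _
    by_cases hy : ∃ j, y ∈ halfSpace (m (i.succAbove j))
    · exact Or.inr (Set.mem_iUnion.2 hy)
    push Not at hy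
    refine Or.inl ⟨?_, ?_⟩
    · obtain ⟨k, hk⟩ := hn.exists_inner_nonpos y
      rcases Fin.eq_self_or_eq_succAbove i k with rfl | ⟨j, rfl⟩
      · rwa [Function.update_self] at hk
      · rw [Function.update_of_ne (Fin.succAbove_ne i j)] at hk
        exact absurd hk (hy j)
    · obtain ⟨k, hk⟩ := h.1.exists_inner_nonpos y
      rcases Fin.eq_self_or_eq_succAbove i k with rfl | ⟨j, rfl⟩
      · exact hk
      · exact absurd hk (hy j)
  have h1 : (1 : ℝ) ≤ μ.real (halfSpace n ∩ halfSpace (m i)) + d * a := by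
    calc (1 : ℝ) = μ.real Set.univ := probReal_univ.symm
      _ ≤ _ := measureReal_mono hcover
      _ ≤ _ := measureReal_union_le _ _
      _ ≤ μ.real (halfSpace n ∩ halfSpace (m i)) +
          ∑ j : Fin d, μ.real (halfSpace (m (i.succAbove j))) := by
        gcongr; exact measureReal_iUnion_fintype_le _
      _ ≤ μ.real (halfSpace n ∩ halfSpace (m i)) + ∑ j : Fin d, a := by
        gcongr with j; exact (h.2 _).le
      _ = _ := by simp
  linarith

variable [FiniteDimensional ℝ V]

-- Carathéodory gives an affinely independent subfamily, hence at most `d + 1` normals. Their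
-- half-spaces cover `V`, and `d` light ones have too little mass for that, so there are exactly `d
-- + 1`.
omit [BorelSpace V] in
theorem exists_posSpanning_of_zero_mem_convexHull (hV : Module.finrank ℝ V = d)
    (ha : (d : ℝ) * a < 1) {s : Set V} (hs : s ⊆ light μ a) (h0 : (0 : V) ∈ convexHull ℝ s) :
    ∃ z : Fin (d + 1) → V, Set.range z ⊆ s ∧ PosSpanning z := by
  obtain ⟨ι, _, z, w, hzs, hz, hw, hw1, hwz⟩ := eq_pos_convex_span_of_mem_convexHull h0
  have hne : Nonempty ι := by
    by_contra hι
    rw [not_nonempty_iff] at hι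
    simp at hw1
  have h1 : 1 ≤ ∑ i, μ.real (halfSpace (z i)) := by
    refine one_le_sum_of_cover μ fun y => ?_
    by_contra! hy
    have hpos : 0 < ∑ i, w i * inner ℝ (z i) y :=
      Finset.sum_pos (fun i _ => mul_pos (hw i) (hy i)) Finset.univ_nonempty
    have := congrArg (fun x => inner ℝ x y) hwz
    simp only [sum_inner, inner_smul_left, inner_zero_left] at this
    exact hpos.ne' this
  have h2 : ∑ i, μ.real (halfSpace (z i)) < Fintype.card ι * a := by
    calc _ < ∑ i : ι, a := Finset.sum_lt_sum_of_nonempty Finset.univ_nonempty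
            fun i _ => hs (hzs ⟨i, rfl⟩)
      _ = _ := by simp
  have ha0 : 0 < a := by
    by_contra! ha0
    exact absurd (mul_nonpos_of_nonneg_of_nonpos (Nat.cast_nonneg (Fintype.card ι)) ha0)
      (by linarith)
  have h3 : d < Fintype.card ι := by
    by_contra! hle
    have : (Fintype.card ι : ℝ) * a ≤ d * a := by gcongr
    linarith
  have h4 : Fintype.card ι ≤ d + 1 := by
    rw [← hV]
    exact hz.card_le_finrank_succ.trans (Nat.succ_le_succ (Submodule.finrank_le _))
  let e : Fin (d + 1) ≃ ι := (Fintype.equivFinOfCardEq (by omega)).symm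
  refine ⟨z ∘ e, ?_, AffineIndependent.posSpanning hV (hz.comp_embedding e.toEmbedding)
    (w := w ∘ e) (fun i => hw _) ?_⟩
  · rwa [e.surjective.range_comp]
  · rw [← hwz]
    exact e.sum_comp fun i => w i • z i

-- The exchange step alone might give a degenerate simplex; lightness of all the normals rules this
-- out.
omit [BorelSpace V] in
theorem IsFrame.exists_posSpanning_update (hV : Module.finrank ℝ V = d) (ha : (d : ℝ) * a < 1)
    {m : Fin (d + 1) → V} (h : IsFrame μ a m) {n : V} (hn : n ∈ light μ a) :
    ∃ i, PosSpanning (Function.update m i n) := by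
  obtain ⟨i, hi⟩ := h.1.exists_zero_mem_convexHull_update hV n
  refine ⟨i, ?_⟩
  obtain ⟨z, hz, hzp⟩ := exists_posSpanning_of_zero_mem_convexHull (μ := μ) (a := a) hV ha
    (s := Set.range (Function.update m i n)) (by
      rintro _ ⟨j, rfl⟩
      rcases eq_or_ne j i with rfl | hj
      · simpa using hn
      · simpa [hj] using h.2 j) hi
  exact hzp.of_range_subset hz

omit [BorelSpace V] [IsProbabilityMeasure μ] [FiniteDimensional ℝ V] in
theorem IsFrame.update {m : Fin (d + 1) → V} (h : IsFrame μ a m) {n : V} (hn : n ∈ light μ a)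
    {i : Fin (d + 1)} (hi : PosSpanning (Function.update m i n)) :
    IsFrame μ a (Function.update m i n) := by
  refine ⟨hi, fun j => ?_⟩
  rcases eq_or_ne j i with rfl | hj
  · simpa using hn
  · simpa [hj] using h.2 j

/-- Two normals are close if their half-spaces have a large overlap. -/
def Close (d : ℕ) (μ : Measure V) (a : ℝ) (p q : V) : Prop :=
  1 - d * a ≤ μ.real (halfSpace p ∩ halfSpace q)

omit [IsProbabilityMeasure μ] [BorelSpace V] [FiniteDimensional ℝ V] in
theorem Close.symm {p q : V} (h : Close d μ a p q) : Close d μ a q p := by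
  rwa [Close, Set.inter_comm]

/-- Exchange `p` into a frame, then `q`. If `q` displaces `p`, the two are close; otherwise both
belong to one frame and `IsFrame.overlap_le` applies. -/
theorem overlap_le_of_not_close (hV : Module.finrank ℝ V = d) (ha : (d : ℝ) * a < 1)
    {m : Fin (d + 1) → V} (h : IsFrame μ a m) {p q : V} (hp : p ∈ light μ a)
    (hq : q ∈ light μ a) (hpq : ¬ Close d μ a p q) :
    μ.real (halfSpace p ∩ halfSpace q) ≤ ((d : ℝ) + 1) * a - 1 := by
  obtain ⟨i, hi⟩ := h.exists_posSpanning_update hV ha hp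
  have h' := h.update hp hi
  obtain ⟨j, hj⟩ := h'.exists_posSpanning_update hV ha hq
  rcases eq_or_ne j i with rfl | hji
  · refine absurd ?_ hpq
    simpa using (show Close d μ a _ _ from le_overlap_of_update h' hj).symm
  · have h'' := h'.update hq hj
    have := h''.overlap_le hji.symm
    simpa [hji.symm] using this

/-- Two large overlaps inside the half-space of `q`, of mass below `a`, intersect in mass above `2 -
2 d a - a`. By `ha` this exceeds `(d + 1) a - 1`, which excludes the small-overlap case for `p` and
`r`. -/
theorem Close.trans (hV : Module.finrank ℝ V = d) (ha : (3 * (d : ℝ) + 2) * a < 3)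
    (ha' : (d : ℝ) * a < 1)
    {m : Fin (d + 1) → V} (h : IsFrame μ a m) {p q r : V} (hp : p ∈ light μ a)
    (hq : q ∈ light μ a) (hr : r ∈ light μ a) (hpq : Close d μ a p q) (hqr : Close d μ a q r) :
    Close d μ a p r := by
  by_contra hpr
  have h1 := overlap_le_of_not_close hV ha' h hp hr hpr
  have h2 := measureReal_union_add_inter (μ := μ) (s := halfSpace p ∩ halfSpace q)
    ((measurableSet_halfSpace q).inter (measurableSet_halfSpace r))
  have h3 : μ.real (halfSpace p ∩ halfSpace q ∪ halfSpace q ∩ halfSpace r) ≤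
      μ.real (halfSpace q) := measureReal_mono (by
    rintro y (hy | hy)
    exacts [hy.2, hy.1])
  have h4 : μ.real (halfSpace p ∩ halfSpace q ∩ (halfSpace q ∩ halfSpace r)) ≤
      μ.real (halfSpace p ∩ halfSpace r) := measureReal_mono fun y hy => ⟨hy.1.1, hy.2.2⟩
  have h5 : μ.real (halfSpace q) < a := hq
  rw [Close] at hpq hqr
  nlinarith

omit [FiniteDimensional ℝ V] in
theorem IsFrame.not_close (ha : (2 * (d : ℝ) + 1) * a < 2) {m : Fin (d + 1) → V}
    (h : IsFrame μ a m) {i j : Fin (d + 1)} (hij : i ≠ j) : ¬ Close d μ a (m i) (m j) := by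
  intro hc
  have := h.overlap_le hij
  rw [Close] at hc
  nlinarith

omit [BorelSpace V] in
theorem IsFrame.exists_close (hV : Module.finrank ℝ V = d) (ha : (d : ℝ) * a < 1)
    {m : Fin (d + 1) → V} (h : IsFrame μ a m) {n : V} (hn : n ∈ light μ a) :
    ∃ i, Close d μ a n (m i) := by
  obtain ⟨i, hi⟩ := h.exists_posSpanning_update hV ha hn
  exact ⟨i, le_overlap_of_update h hi⟩

-- Once `n` belongs to a frame, exchanging it for itself bounds its own mass below.
omit [BorelSpace V] in
theorem Close.refl (hV : Module.finrank ℝ V = d) (ha : (d : ℝ) * a < 1)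
    {m : Fin (d + 1) → V} (h : IsFrame μ a m) {n : V} (hn : n ∈ light μ a) :
    Close d μ a n n := by
  obtain ⟨i, hi⟩ := h.exists_posSpanning_update hV ha hn
  have h' := h.update hn hi
  have hc : Close d μ a _ _ := le_overlap_of_update (n := n) (i := i) h' (by simpa using hi)
  simpa using hc

/-- A member of a frame may be replaced by any light normal that is close to it. -/
theorem IsFrame.update_of_close (hV : Module.finrank ℝ V = d) (ha : (3 * (d : ℝ) + 2) * a < 3)
    (ha' : (d : ℝ) * a < 1) (ha'' : (2 * (d : ℝ) + 1) * a < 2)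
    {m : Fin (d + 1) → V} (h : IsFrame μ a m) {n : V}
    (hn : n ∈ light μ a) {i : Fin (d + 1)} (hi : Close d μ a n (m i)) :
    IsFrame μ a (Function.update m i n) := by
  obtain ⟨j, hj⟩ := h.exists_posSpanning_update hV ha' hn
  have hc : Close d μ a n (m j) := le_overlap_of_update h hj
  -- The slot `j` offered by the exchange must be `i`, since otherwise two different frame members
  -- would be close through `n`.
  rcases eq_or_ne j i with rfl | hji
  · exact h.update hn hj
  · exact absurd (Close.trans hV ha ha' h (h.2 j) hn (h.2 i) hc.symm hi) (h.not_close ha'' hji)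

theorem IsFrame.of_close (hV : Module.finrank ℝ V = d) (ha : (3 * (d : ℝ) + 2) * a < 3)
    (ha' : (d : ℝ) * a < 1) (ha'' : (2 * (d : ℝ) + 1) * a < 2)
    {m u : Fin (d + 1) → V} (h : IsFrame μ a m) (hu : ∀ i, u i ∈ light μ a)
    (hc : ∀ i, Close d μ a (u i) (m i)) : IsFrame μ a u := by
  have key : ∀ s : Finset (Fin (d + 1)), IsFrame μ a (s.piecewise u m) := by
    intro s
    induction s using Finset.induction_on with
    | empty => simpa using h
    | insert k s hk ih =>
      rw [Finset.piecewise_insert]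
      exact ih.update_of_close hV ha ha' ha'' (hu k) (by simpa [hk] using hc k)
  simpa using key Finset.univ

/-- Two frames agree up to a permutation and closeness. -/
theorem IsFrame.exists_perm (hV : Module.finrank ℝ V = d) (ha : (3 * (d : ℝ) + 2) * a < 3)
    (ha' : (d : ℝ) * a < 1) (ha'' : (2 * (d : ℝ) + 1) * a < 2)
    {m m' : Fin (d + 1) → V} (h : IsFrame μ a m) (h' : IsFrame μ a m') :
    ∃ σ : Equiv.Perm (Fin (d + 1)), ∀ i, Close d μ a (m' i) (m (σ i)) := by
  choose σ hσ using fun i => h.exists_close hV ha' (h'.2 i)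
  have hinj : Function.Injective σ := by
    intro i j hij
    by_contra hne
    refine h'.not_close ha'' hne (Close.trans hV ha ha' h (h'.2 i) (h.2 (σ i)) (h'.2 j) (hσ i) ?_)
    rw [hij]
    exact (hσ j).symm
  exact ⟨Equiv.ofBijective σ (Finite.injective_iff_bijective.1 hinj), hσ⟩

end Light

/-! ### Nice measures of half-spaces -/

section Nice

open Filter Topology

variable {V : Type*} [NormedAddCommGroup V] [InnerProductSpace ℝ V] [FiniteDimensional ℝ V]
  [MeasurableSpace V] [BorelSpace V]

instance (ν : NiceMeasure V) : IsProbabilityMeasure ν.toMeasure := ν.isProbabilityMeasure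

theorem NiceMeasure.absolutelyContinuous (ν : NiceMeasure V) : ν.toMeasure ≪ volume := by
  rw [ν.toMeasure_eq]
  exact withDensity_absolutelyContinuous _ _

theorem NiceMeasure.measureReal_pos (ν : NiceMeasure V) {s : Set V} (hs : IsOpen s)
    (hne : s.Nonempty) : 0 < ν.toMeasure.real s := by
  refine ENNReal.toReal_pos (fun h => ?_) (measure_ne_top _ _)
  have hac : (volume : Measure V) ≪ ν.toMeasure := by
    rw [ν.toMeasure_eq]
    exact withDensity_absolutelyContinuous'
      ν.continuous_density.measurable.ennreal_ofReal.aemeasurable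
      (Eventually.of_forall fun x => by simpa using ν.density_pos x)
  exact (hs.measure_pos volume hne).ne' (hac h)

theorem volume_inner_eq {n : V} (hn : n ≠ 0) (c : ℝ) :
    (volume : Measure V) {y | inner ℝ n y = c} = 0 := by
  have hne : ∃ y : V, inner ℝ n y ≠ c := by
    by_cases hc : c = 0
    · exact ⟨n, by rw [hc]; exact inner_self_ne_zero.2 hn⟩
    · exact ⟨0, by simpa using Ne.symm hc⟩
  obtain ⟨y, hy⟩ := hne
  let A : AffineSubspace ℝ V :=
    (AffineSubspace.mk' c ⊥).comap (innerSL ℝ n).toLinearMap.toAffineMap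
  have hA : (A : Set V) = {y | inner ℝ n y = c} := by
    ext z
    simp [A, AffineSubspace.mem_mk', sub_eq_zero]
  rw [← hA]
  refine Measure.addHaar_affineSubspace _ _ fun h => hy ?_
  have : y ∈ (A : Set V) := by rw [h]; trivial
  rwa [hA] at this

/-- The mass of the part of a set in a closed half-space depends continuously on the half-space. -/
theorem NiceMeasure.tendsto_measureReal_inter {ι : Type*} {l : Filter ι} [l.IsCountablyGenerated]
    (ν : NiceMeasure V) {n : ι → V} {c : ι → ℝ} {n₀ : V} {c₀ : ℝ} (hn₀ : n₀ ≠ 0)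
    (hn : Tendsto n l (𝓝 n₀)) (hc : Tendsto c l (𝓝 c₀)) {B : Set V} (hB : MeasurableSet B) :
    Tendsto (fun i => ν.toMeasure.real ({y | inner ℝ (n i) y ≤ c i} ∩ B)) l
      (𝓝 (ν.toMeasure.real ({y | inner ℝ n₀ y ≤ c₀} ∩ B))) := by
  have hmeas : ∀ (p : V) (t : ℝ), MeasurableSet ({y | inner ℝ p y ≤ t} ∩ B) := fun p t =>
    ((isClosed_le (by fun_prop) continuous_const).measurableSet).inter hB
  refine (ENNReal.tendsto_toReal (measure_ne_top _ _)).comp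
    (tendsto_measure_of_ae_tendsto_indicator_of_isFiniteMeasure l (hmeas _ _)
      (fun i => hmeas _ _) ?_)
  -- Indicators converge off the limiting boundary hyperplane, which is null because `n₀ ≠ 0`.
  have hae : ∀ᵐ y ∂ν.toMeasure, inner ℝ n₀ y ≠ c₀ :=
    measure_eq_zero_iff_ae_notMem.1 (ν.absolutelyContinuous (volume_inner_eq hn₀ c₀))
  filter_upwards [hae] with y hy
  have hlim : Tendsto (fun i => inner ℝ (n i) y) l (𝓝 (inner ℝ n₀ y)) :=
    hn.inner tendsto_const_nhds
  rcases hy.lt_or_gt with h | h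
  · filter_upwards [hlim.eventually_lt hc h] with i hi
    simp [hi.le, h.le]
  · filter_upwards [hc.eventually_lt hlim h] with i hi
    simp [hi.not_ge, h.not_ge]

theorem NiceMeasure.continuousAt_measureReal_halfSpace_inter (ν : NiceMeasure V) {n₀ : V}
    (hn₀ : n₀ ≠ 0) {B : Set V} (hB : MeasurableSet B) :
    ContinuousAt (fun n => ν.toMeasure.real (halfSpace n ∩ B)) n₀ :=
  ν.tendsto_measureReal_inter hn₀ tendsto_id tendsto_const_nhds hB

theorem NiceMeasure.continuousAt_measureReal_halfSpace (ν : NiceMeasure V) {n₀ : V}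
    (hn₀ : n₀ ≠ 0) : ContinuousAt (fun n => ν.toMeasure.real (halfSpace n)) n₀ := by
  simpa using ν.continuousAt_measureReal_halfSpace_inter hn₀ MeasurableSet.univ

/-- The mass of a fixed set is a continuous function of the measure. -/
theorem NiceMeasure.continuous_measureReal {s : Set V} (hs : MeasurableSet s) :
    Continuous fun ν : NiceMeasure V => ν.toMeasure.real s := by
  have heq : ∀ ν : NiceMeasure V, ν.toMeasure.real s = ∫ x in s, ν.density x := fun ν => by
    rw [integral_eq_lintegral_of_nonneg_ae (Eventually.of_forall fun x => (ν.density_pos x).le)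
      ν.continuous_density.aestronglyMeasurable, Measure.real, ν.toMeasure_eq,
      withDensity_apply _ hs]
  refine LipschitzWith.continuous (K := 1) (LipschitzWith.of_dist_le_mul fun ν ν' => ?_)
  have hi := ν.integrable_density
  have hi' := ν'.integrable_density
  rw [heq, heq, Real.dist_eq, ← integral_sub hi.integrableOn hi'.integrableOn, NNReal.coe_one,
    one_mul]
  calc |∫ x in s, (ν.density x - ν'.density x)|
      ≤ ∫ x in s, |ν.density x - ν'.density x| := abs_integral_le_integral_abs
    _ ≤ ∫ x, |ν.density x - ν'.density x| :=
      setIntegral_le_integral (hi.sub hi').abs (Eventually.of_forall fun x => abs_nonneg _)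

omit [FiniteDimensional ℝ V] [BorelSpace V] in
theorem ne_zero_of_mem_light {μ : Measure V} [IsProbabilityMeasure μ] {a : ℝ} (ha : a ≤ 1) {n : V}
    (hn : n ∈ light μ a) : n ≠ 0 := by
  rintro rfl
  have : halfSpace (0 : V) = Set.univ := by ext; simp [halfSpace]
  rw [light, Set.mem_ofPred_eq, this, probReal_univ] at hn
  linarith

theorem NiceMeasure.isOpen_light (ν : NiceMeasure V) {a : ℝ} (ha : a ≤ 1) :
    IsOpen (light ν.toMeasure a) :=
  isOpen_iff_mem_nhds.2 fun _ hn =>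
    (ν.continuousAt_measureReal_halfSpace (ne_zero_of_mem_light ha hn)).eventually_lt
      continuousAt_const hn

/-! ### Depth and light half-spaces -/

omit [FiniteDimensional ℝ V] [BorelSpace V] in
theorem depth_le {μ : Measure V} {x n : V} {c : ℝ} (hn : n ≠ 0) (hc : inner ℝ n x ≤ c) :
    depth μ x ≤ μ.real {y | inner ℝ n y ≤ c} :=
  csInf_le ⟨0, by rintro _ ⟨H, -, rfl⟩; exact measureReal_nonneg⟩
    ⟨_, ⟨⟨n, hn, c, rfl⟩, hc⟩, rfl⟩

/-- Only half-spaces with unit normal and `x` on the boundary matter, and their mass is continuous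
on the compact unit sphere. -/
theorem NiceMeasure.exists_le_depth [Nontrivial V] (ν : NiceMeasure V) (x : V) :
    ∃ n : V, ‖n‖ = 1 ∧
      ν.toMeasure.real {y | inner ℝ n y ≤ inner ℝ n x} ≤ depth ν.toMeasure x := by
  have hcont : ContinuousOn (fun n => ν.toMeasure.real {y | inner ℝ n y ≤ inner ℝ n x})
      (Metric.sphere (0 : V) 1) := by
    intro n hn
    have hn0 : n ≠ 0 := ne_zero_of_mem_unit_sphere ⟨n, hn⟩
    have h := ν.tendsto_measureReal_inter (l := 𝓝 n) hn0 tendsto_id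
      (c := fun p => inner ℝ p x) (c₀ := inner ℝ n x)
      (Continuous.tendsto (by fun_prop) n) MeasurableSet.univ
    simp only [Set.inter_univ] at h
    exact ContinuousAt.continuousWithinAt h
  obtain ⟨n, hn, hmin⟩ := (isCompact_sphere (0 : V) 1).exists_isMinOn
    (NormedSpace.sphere_nonempty.2 zero_le_one) hcont
  refine ⟨n, by simpa using hn, le_csInf ?_ ?_⟩
  · obtain ⟨p, hp⟩ := exists_ne (0 : V)
    exact ⟨_, _, ⟨⟨p, hp, inner ℝ p x, rfl⟩, show inner ℝ p x ≤ inner ℝ p x from le_rfl⟩, rfl⟩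
  · rintro _ ⟨_, ⟨⟨p, hp, c, rfl⟩, hx⟩, rfl⟩
    have hp0 : 0 < ‖p‖⁻¹ := inv_pos.2 (norm_pos_iff.2 hp)
    have hp1 : ‖p‖⁻¹ • p ∈ Metric.sphere (0 : V) 1 := by
      simp [norm_smul, (norm_pos_iff.2 hp).ne']
    refine (isMinOn_iff.1 hmin _ hp1).trans (measureReal_mono fun y hy => ?_)
    simp only [Set.mem_ofPred_eq, inner_smul_left, RCLike.conj_to_real] at hx hy ⊢
    exact (le_of_mul_le_mul_left hy hp0).trans hx

theorem NiceMeasure.measureReal_halfSpace_lt (ν : NiceMeasure V) {n : V} (hn : n ≠ 0) {c : ℝ}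
    (hc : 0 < c) :
    ν.toMeasure.real (halfSpace n) < ν.toMeasure.real {y | inner ℝ n y ≤ c} := by
  set s : Set V := {y | 0 < inner ℝ n y} ∩ {y | inner ℝ n y < c} with hs
  have hso : IsOpen s := (isOpen_lt continuous_const (by fun_prop)).inter
    (isOpen_lt (by fun_prop) continuous_const)
  have hn2 : 0 < ‖n‖ ^ 2 := by have := norm_pos_iff.2 hn; positivity
  have hsne : s.Nonempty := ⟨(c / 2 / ‖n‖ ^ 2) • n, by
    simp only [hs, Set.mem_inter_iff, Set.mem_ofPred_eq, inner_smul_right,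
      real_inner_self_eq_norm_sq]
    rw [div_mul_cancel₀ _ hn2.ne']
    constructor <;> linarith⟩
  have hdisj : Disjoint (halfSpace n) s := Set.disjoint_left.2 fun y hy hy' =>
    (not_lt.2 (show inner ℝ n y ≤ 0 from hy)) hy'.1
  calc _ < ν.toMeasure.real (halfSpace n) + ν.toMeasure.real s :=
        lt_add_of_pos_right _ (ν.measureReal_pos hso hsne)
    _ = ν.toMeasure.real (halfSpace n ∪ s) := (measureReal_union hdisj hso.measurableSet).symm
    _ ≤ _ := measureReal_mono (by
      rintro y (hy | hy)
      · exact le_trans (show inner ℝ n y ≤ 0 from hy) hc.le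
      · exact (show inner ℝ n y < c from hy.2).le)

omit [FiniteDimensional ℝ V] [BorelSpace V] in
theorem depth_le_of_isTukeyMedian {μ : Measure V} [IsProbabilityMeasure μ] [Nontrivial V] {o : V}
    (h : IsTukeyMedian μ o) (x : V) : depth μ x ≤ depth μ o := by
  rw [h]
  obtain ⟨p, hp⟩ := exists_ne (0 : V)
  exact le_ciSup (f := fun x => depth μ x)
    ⟨1, by rintro _ ⟨y, rfl⟩; exact (depth_le hp le_rfl).trans measureReal_le_one⟩ x

/-- At a Tukey median, the normals of the light half-spaces surround the origin. -/
theorem NiceMeasure.zero_mem_convexHull_light [Nontrivial V] (ν : NiceMeasure V) {a : ℝ}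
    (ha : a ≤ 1) (hν : ν ∈ centred V a) : (0 : V) ∈ convexHull ℝ (light ν.toMeasure a) := by
  by_contra h0
  obtain ⟨f, hf⟩ := geometric_hahn_banach_open_point (convex_convexHull ℝ _)
    (ν.isOpen_light ha).convexHull h0
  obtain ⟨v, rfl⟩ := (InnerProductSpace.toDual ℝ V).surjective f
  simp only [InnerProductSpace.toDual_apply_apply, inner_zero_right] at hf
  have hlight : ∀ n ∈ light ν.toMeasure a, 0 < inner ℝ n (-v) := fun n hn => by
    have := hf n (subset_convexHull ℝ _ hn)
    rw [inner_neg_right, real_inner_comm]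
    linarith
  -- Points tending to the median along `-v`, the direction in which every light normal increases.
  -- Lightest half-spaces at these points have normals that subconverge to a light normal.
  set x : ℕ → V := fun k => (1 / ((k : ℝ) + 1)) • (-v) with hx
  have hxlim : Tendsto x atTop (𝓝 0) := by
    simpa [hx] using (tendsto_one_div_add_atTop_nhds_zero_nat (𝕜 := ℝ)).smul_const (-v)
  choose n hn1 hn using fun k => ν.exists_le_depth (x k)
  obtain ⟨n₀, hn₀, φ, hφ, hlim⟩ := (isCompact_sphere (0 : V) 1).tendsto_subseq
    (x := n) fun k => by simp [hn1]
  have hn₀0 : n₀ ≠ 0 := ne_zero_of_mem_unit_sphere ⟨n₀, hn₀⟩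
  have hmed : ∀ k, ν.toMeasure.real {y | inner ℝ (n k) y ≤ inner ℝ (n k) (x k)} ≤
      depth ν.toMeasure 0 := fun k => (hn k).trans (depth_le_of_isTukeyMedian hν.2 _)
  have hmlt : depth ν.toMeasure 0 < a := by
    rw [hν.2]
    exact hν.1
  have hinner : Tendsto (fun k => inner ℝ (n (φ k)) (x (φ k))) atTop (𝓝 0) := by
    simpa using hlim.inner (hxlim.comp hφ.tendsto_atTop)
  have hmass := ν.tendsto_measureReal_inter hn₀0 hlim hinner MeasurableSet.univ
  simp only [Set.inter_univ] at hmass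
  have hn₀l : n₀ ∈ light ν.toMeasure a :=
    (le_of_tendsto hmass (Eventually.of_forall fun k => hmed _)).trans_lt hmlt
  have hev : ∀ᶠ k in atTop, 0 < inner ℝ (n (φ k)) (-v) :=
    (tendsto_const_nhds.eventually_lt (hlim.inner tendsto_const_nhds) (hlight n₀ hn₀l))
  obtain ⟨k, hk⟩ := hev.exists
  have hnk : n (φ k) ≠ 0 := by
    rw [← norm_ne_zero_iff, hn1]
    exact one_ne_zero
  have hpos : 0 < inner ℝ (n (φ k)) (x (φ k)) := by
    rw [hx, inner_smul_right]
    positivity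
  -- The half-space with this normal at the origin is strictly lighter than its translate at the
  -- moved point, hence lighter than the depth of the median.
  have h1 := (ν.measureReal_halfSpace_lt hnk hpos).trans_le (hmed (φ k))
  exact h1.not_ge (depth_le hnk (by simp))

theorem NiceMeasure.exists_isFrame {d : ℕ} (hV : Module.finrank ℝ V = d) {a : ℝ}
    (ha : (3 * (d : ℝ) + 2) * a < 3) (ha' : (d : ℝ) * a < 1) (ha1 : 1 < ((d : ℝ) + 1) * a)
    (ν : NiceMeasure V) (hν : ν ∈ centred V a) :
    ∃ m : Fin (d + 1) → V, IsFrame ν.toMeasure a m := by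
  rcases Nat.eq_zero_or_pos d with rfl | hd
  · have := Module.finrank_zero_iff.1 hV
    refine ⟨0, fun v hv => absurd (Subsingleton.elim v 0) hv, fun i => ?_⟩
    exact measureReal_le_one.trans_lt (by simpa using ha1)
  · have : Nontrivial V := Module.nontrivial_of_finrank_pos (R := ℝ) (hV ▸ hd)
    have hd' : (1 : ℝ) ≤ d := by exact_mod_cast hd
    have ha2 : a ≤ 1 := by nlinarith
    obtain ⟨z, hz, hzp⟩ := exists_posSpanning_of_zero_mem_convexHull hV ha' subset_rfl
      (ν.zero_mem_convexHull_light ha2 hν)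
    exact ⟨z, hzp, fun i => hz ⟨i, rfl⟩⟩

end Nice

/-! ### The axes of a nice measure -/

section Axis

open Filter Topology

/-- A continuous function that separates the possible overlaps of light half-spaces. -/
def cutoff (d : ℕ) (a t : ℝ) : ℝ :=
  -- A linear ramp across the gap between the two overlap bounds; the denominator is the length of
  -- the gap.
  max 0 (min 1 ((t - (((d : ℝ) + 1) * a - 1)) / (2 - (2 * (d : ℝ) + 1) * a)))

theorem continuous_cutoff (d : ℕ) (a : ℝ) : Continuous (cutoff d a) := by
  unfold cutoff
  fun_prop

theorem cutoff_nonneg (d : ℕ) (a t : ℝ) : 0 ≤ cutoff d a t := le_max_left _ _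

theorem cutoff_le_one (d : ℕ) (a t : ℝ) : cutoff d a t ≤ 1 :=
  max_le zero_le_one (min_le_left _ _)

theorem cutoff_eq_zero {d : ℕ} {a t : ℝ} (ha : (2 * (d : ℝ) + 1) * a < 2)
    (ht : t ≤ ((d : ℝ) + 1) * a - 1) : cutoff d a t = 0 :=
  max_eq_left ((min_le_right _ _).trans
    (div_nonpos_of_nonpos_of_nonneg (by linarith) (by linarith)))

theorem cutoff_eq_one {d : ℕ} {a t : ℝ} (ha : (2 * (d : ℝ) + 1) * a < 2)
    (ht : 1 - (d : ℝ) * a ≤ t) : cutoff d a t = 1 := by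
  have h : 1 ≤ (t - (((d : ℝ) + 1) * a - 1)) / (2 - (2 * (d : ℝ) + 1) * a) :=
    (one_le_div (by linarith)).2 (by linarith)
  rw [cutoff, min_eq_left h, max_eq_right zero_le_one]

variable {V : Type*} [NormedAddCommGroup V] [InnerProductSpace ℝ V] [FiniteDimensional ℝ V]
  [MeasurableSpace V] [BorelSpace V] {d : ℕ} {a : ℝ}

/-- The weight of the normal `n` in the axis of the normal `p`. -/
def weight (d : ℕ) (a : ℝ) (ν : NiceMeasure V) (p n : V) : ℝ :=
  -- This factor fades to zero as `n` ceases to be light, so the weight is continuous in the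
  -- measure.
  max (a - ν.toMeasure.real (halfSpace n)) 0 *
    cutoff d a (ν.toMeasure.real (halfSpace n ∩ halfSpace p))

/-- The weighted mean of the light normals that are close to `p`. -/
def axis (d : ℕ) (a : ℝ) (ν : NiceMeasure V) (p : V) : V :=
  -- Weights are invariant under positive scaling of `n`; the unit ball makes the integral finite
  -- and is preserved by isometries.
  ∫ n in Metric.ball (0 : V) 1, weight d a ν p n • n

theorem weight_nonneg (ν : NiceMeasure V) (p n : V) : 0 ≤ weight d a ν p n :=
  mul_nonneg (le_max_right _ _) (cutoff_nonneg _ _ _)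

theorem weight_le (ν : NiceMeasure V) (p n : V) : weight d a ν p n ≤ |a| := by
  have h1 : max (a - ν.toMeasure.real (halfSpace n)) 0 ≤ |a| :=
    max_le ((sub_le_self _ measureReal_nonneg).trans (le_abs_self a)) (abs_nonneg a)
  calc weight d a ν p n ≤ |a| * 1 :=
        mul_le_mul h1 (cutoff_le_one _ _ _) (cutoff_nonneg _ _ _) (abs_nonneg a)
    _ = |a| := mul_one _

theorem weight_eq_zero_of_notMem (ν : NiceMeasure V) (p : V) {n : V}
    (hn : n ∉ light ν.toMeasure a) : weight d a ν p n = 0 := by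
  rw [weight, max_eq_right (sub_nonpos.2 (not_lt.1 hn)), zero_mul]

theorem weight_eq_zero_of_not_close (hV : Module.finrank ℝ V = d) (ha' : (d : ℝ) * a < 1)
    (ha'' : (2 * (d : ℝ) + 1) * a < 2) {ν : NiceMeasure V} {m : Fin (d + 1) → V}
    (h : IsFrame ν.toMeasure a m) {p n : V} (hp : p ∈ light ν.toMeasure a)
    (hn : n ∈ light ν.toMeasure a) (hc : ¬ Close d ν.toMeasure a n p) :
    weight d a ν p n = 0 := by
  rw [weight, cutoff_eq_zero ha'' (overlap_le_of_not_close hV ha' h hn hp hc), mul_zero]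

theorem weight_eq_of_close (ha'' : (2 * (d : ℝ) + 1) * a < 2) {ν : NiceMeasure V} {p n : V}
    (hn : n ∈ light ν.toMeasure a) (hc : Close d ν.toMeasure a n p) :
    weight d a ν p n = a - ν.toMeasure.real (halfSpace n) := by
  rw [weight, cutoff_eq_one ha'' hc, mul_one, max_eq_left (sub_pos.2 hn).le]

theorem measurable_measureReal_halfSpace_inter (ν : NiceMeasure V) {B : Set V}
    (hB : MeasurableSet B) : Measurable fun n => ν.toMeasure.real (halfSpace n ∩ B) := by
  have hs : MeasurableSet {q : V × V | inner ℝ q.1 q.2 ≤ 0 ∧ q.2 ∈ B} :=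
    (isClosed_le (f := fun q : V × V => inner ℝ q.1 q.2) (by fun_prop)
      continuous_const).measurableSet.inter (measurable_snd hB)
  exact (measurable_measure_prodMk_left hs).ennreal_toReal

theorem measurable_weight (ν : NiceMeasure V) (p : V) : Measurable (weight d a ν p) := by
  have h1 : Measurable fun n => ν.toMeasure.real (halfSpace n) := by
    simpa using measurable_measureReal_halfSpace_inter ν MeasurableSet.univ
  exact ((measurable_const.sub h1).max measurable_const).mul
    ((continuous_cutoff d a).measurable.comp
      (measurable_measureReal_halfSpace_inter ν (measurableSet_halfSpace p)))

theorem continuousAt_weight (ν : NiceMeasure V) (p : V) {n : V} (hn : n ≠ 0) :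
    ContinuousAt (weight d a ν p) n :=
  ((continuousAt_const.sub (ν.continuousAt_measureReal_halfSpace hn)).max
    continuousAt_const).mul ((continuous_cutoff d a).continuousAt.comp
      (ν.continuousAt_measureReal_halfSpace_inter hn (measurableSet_halfSpace p)))

theorem norm_weight_smul_le (ν : NiceMeasure V) (p : V) {n : V}
    (hn : n ∈ Metric.ball (0 : V) 1) : ‖weight d a ν p n • n‖ ≤ |a| := by
  rw [norm_smul, Real.norm_of_nonneg (weight_nonneg _ _ _)]
  calc _ ≤ |a| * 1 := mul_le_mul (weight_le _ _ _) (mem_ball_zero_iff.1 hn).le (norm_nonneg _)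
        (abs_nonneg a)
    _ = |a| := mul_one _

theorem aestronglyMeasurable_weight_smul (ν : NiceMeasure V) (p : V) {μ : Measure V} :
    AEStronglyMeasurable (fun n => weight d a ν p n • n) μ :=
  ((measurable_weight ν p).smul measurable_id).aestronglyMeasurable

theorem integrableOn_weight_smul (ν : NiceMeasure V) (p : V) :
    IntegrableOn (fun n => weight d a ν p n • n) (Metric.ball (0 : V) 1) :=
  Measure.integrableOn_of_bounded (M := |a|) measure_ball_lt_top.ne
    (aestronglyMeasurable_weight_smul ν p)
    ((ae_restrict_iff' measurableSet_ball).2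
      (Eventually.of_forall fun _ hn => norm_weight_smul_le ν p hn))

/-- With `p` fixed, each weight involves masses of fixed sets only, so dominated convergence
applies. -/
theorem continuous_axis (p : V) : Continuous fun ν : NiceMeasure V => axis d a ν p := by
  refine continuous_of_dominated (bound := fun _ => |a|)
    (fun ν => aestronglyMeasurable_weight_smul ν p) (fun ν => ?_) ?_ ?_
  · exact (ae_restrict_iff' measurableSet_ball).2
      (Eventually.of_forall fun _ hn => norm_weight_smul_le ν p hn)
  · exact integrableOn_const measure_ball_lt_top.ne
  · refine Eventually.of_forall fun n => Continuous.smul ?_ continuous_const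
    exact ((continuous_const.sub
      (NiceMeasure.continuous_measureReal (measurableSet_halfSpace n))).max continuous_const).mul
      ((continuous_cutoff d a).comp (NiceMeasure.continuous_measureReal
        ((measurableSet_halfSpace n).inter (measurableSet_halfSpace p))))

/-- The axis depends only on the closeness class of the normal. -/
theorem axis_eq_of_close (hV : Module.finrank ℝ V = d) (ha : (3 * (d : ℝ) + 2) * a < 3)
    (ha' : (d : ℝ) * a < 1) (ha'' : (2 * (d : ℝ) + 1) * a < 2) {ν : NiceMeasure V}
    {m : Fin (d + 1) → V} (h : IsFrame ν.toMeasure a m) {p q : V}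
    (hp : p ∈ light ν.toMeasure a) (hq : q ∈ light ν.toMeasure a)
    (hpq : Close d ν.toMeasure a p q) : axis d a ν p = axis d a ν q := by
  -- On light normals the cutoff only takes the values 0 and 1, and transitivity makes it the same
  -- for `p` and `q`.
  have hw : weight d a ν p = weight d a ν q := by
    ext n
    by_cases hn : n ∈ light ν.toMeasure a
    · by_cases hnp : Close d ν.toMeasure a n p
      · rw [weight_eq_of_close ha'' hn hnp,
          weight_eq_of_close ha'' hn (Close.trans hV ha ha' h hn hp hq hnp hpq)]
      · rw [weight_eq_zero_of_not_close hV ha' ha'' h hp hn hnp,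
          weight_eq_zero_of_not_close hV ha' ha'' h hq hn fun hnq =>
            hnp (Close.trans hV ha ha' h hn hq hp hnq hpq.symm)]
    · rw [weight_eq_zero_of_notMem ν p hn, weight_eq_zero_of_notMem ν q hn]
  rw [axis, axis, hw]

omit [FiniteDimensional ℝ V] [MeasurableSpace V] [BorelSpace V] in
theorem halfSpace_smul {c : ℝ} (hc : 0 < c) (n : V) : halfSpace (c • n) = halfSpace n := by
  ext y
  simp [halfSpace, inner_smul_left, mul_nonpos_iff_pos_imp_nonpos, hc, hc.le]

/-- The integrand is nonnegative, and positive near a small multiple of `p`, which has the same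
weight as `p`. -/
theorem inner_axis_pos (hV : Module.finrank ℝ V = d) (ha' : (d : ℝ) * a < 1)
    (ha'' : (2 * (d : ℝ) + 1) * a < 2) (ha1 : a ≤ 1) {ν : NiceMeasure V} {m : Fin (d + 1) → V}
    (h : IsFrame ν.toMeasure a m) {p v : V} (hp : p ∈ light ν.toMeasure a)
    (hv : ∀ n ∈ light ν.toMeasure a, Close d ν.toMeasure a n p → 0 < inner ℝ n v) :
    0 < inner ℝ (axis d a ν p) v := by
  have hint := integrableOn_weight_smul (d := d) (a := a) ν p
  have heq : inner ℝ (axis d a ν p) v =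
      ∫ n in Metric.ball (0 : V) 1, weight d a ν p n * inner ℝ n v := by
    rw [real_inner_comm, axis, ← integral_inner hint]
    exact integral_congr_ae (Eventually.of_forall fun n => by
      simp [inner_smul_right, real_inner_comm])
  have hpos : ∀ n, weight d a ν p n ≠ 0 → 0 < inner ℝ n v := fun n hn => by
    have hl : n ∈ light ν.toMeasure a := by
      by_contra hl
      exact hn (weight_eq_zero_of_notMem ν p hl)
    refine hv n hl ?_
    by_contra hc
    exact hn (weight_eq_zero_of_not_close hV ha' ha'' h hp hl hc)
  have hp0 := ne_zero_of_mem_light ha1 hp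
  have hpn : 0 < ‖p‖ := norm_pos_iff.2 hp0
  obtain ⟨c, hc, hcp⟩ : ∃ c : ℝ, 0 < c ∧ c • p ∈ Metric.ball (0 : V) 1 :=
    ⟨1 / 2 / ‖p‖, by positivity, by
      rw [mem_ball_zero_iff, norm_smul, Real.norm_of_nonneg (by positivity),
        div_mul_cancel₀ _ hpn.ne']
      norm_num⟩
  have hwp : 0 < weight d a ν p (c • p) := by
    have hw : weight d a ν p (c • p) = weight d a ν p p := by
      simp only [weight, halfSpace_smul hc]
    rw [hw, weight_eq_of_close ha'' hp (Close.refl hV ha' h hp)]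
    exact sub_pos.2 hp
  have hcp0 : c • p ≠ 0 := smul_ne_zero hc.ne' hp0
  have hnhds : {n | weight d a ν p n ≠ 0} ∩ Metric.ball (0 : V) 1 ∈ 𝓝 (c • p) :=
    inter_mem ((continuousAt_weight ν p hcp0).eventually_ne hwp.ne')
      (Metric.isOpen_ball.mem_nhds hcp)
  rw [heq, setIntegral_pos_iff_support_of_nonneg_ae]
  · refine (Measure.measure_pos_of_mem_nhds volume hnhds).trans_le (measure_mono ?_)
    rintro n ⟨hn, hnb⟩
    exact ⟨mul_ne_zero hn (hpos n hn).ne', hnb⟩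
  · refine Eventually.of_forall fun n => ?_
    by_cases hn : weight d a ν p n = 0
    · simp [hn]
    · exact mul_nonneg (weight_nonneg _ _ _) (hpos n hn).le
  · have := hint.inner_const (𝕜 := ℝ) v
    simpa [IntegrableOn, inner_smul_left] using this

/-- The axes of a frame positively span. -/
theorem IsFrame.posSpanning_axis (hV : Module.finrank ℝ V = d)
    (ha : (3 * (d : ℝ) + 2) * a < 3)
    (ha' : (d : ℝ) * a < 1) (ha'' : (2 * (d : ℝ) + 1) * a < 2) {ν : NiceMeasure V}
    {m : Fin (d + 1) → V} (h : IsFrame ν.toMeasure a m) :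
    PosSpanning fun i => axis d a ν (m i) := by
  -- Induction on the slots already filled with axes. The other slots must hold arbitrary light
  -- normals of their classes, so that a slot can vary over its whole class before being averaged.
  have key : ∀ (s : Finset (Fin (d + 1))) (u : Fin (d + 1) → V),
      (∀ i, u i ∈ light ν.toMeasure a) → (∀ i, Close d ν.toMeasure a (u i) (m i)) →
      PosSpanning (s.piecewise (fun i => axis d a ν (m i)) u) := by
    intro s
    induction s using Finset.induction_on with
    | empty =>
      intro u hu hc
      simpa using (h.of_close hV ha ha' ha'' hu hc).1
    | insert k s hk ih =>
      intro u hu hc v hv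
      have hd : 0 < d := by
        rw [← hV]
        exact Module.finrank_pos_iff_exists_ne_zero.2 ⟨v, hv⟩
      have hd' : (1 : ℝ) ≤ d := by exact_mod_cast hd
      have ha1 : a ≤ 1 := by nlinarith
      by_contra! hle
      have hk' := hle k
      rw [Finset.piecewise_insert_self] at hk'
      -- No other slot has positive product with `v`, so by induction every `n` in the class of slot
      -- `k` does, and then so does their mean.
      refine hk'.not_gt (inner_axis_pos hV ha' ha'' ha1 h (h.2 k) fun n hn hnk => ?_)
      obtain ⟨i, hi⟩ := ih (Function.update u k n)
        (fun i => by
          rcases eq_or_ne i k with rfl | hik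
          · simpa using hn
          · simpa [hik] using hu i)
        (fun i => by
          rcases eq_or_ne i k with rfl | hik
          · simpa using hnk
          · simpa [hik] using hc i) v hv
      rcases eq_or_ne i k with rfl | hik
      · simpa [hk] using hi
      · refine absurd (hle i) (not_le.2 ?_)
        by_cases his : i ∈ s
        · simpa [his] using hi
        · simpa [his, hik] using hi
  simpa using key Finset.univ m h.2 fun i => Close.refl hV ha' h (h.2 i)

/-- Independence of the chosen frame: two frames match class by class up to a permutation, and axes
are constant on classes. -/
theorem mk_axis_eq (hV : Module.finrank ℝ V = d) (ha : (3 * (d : ℝ) + 2) * a < 3)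
    (ha' : (d : ℝ) * a < 1) (ha'' : (2 * (d : ℝ) + 1) * a < 2) {ν : NiceMeasure V}
    {m m' : Fin (d + 1) → V} (h : IsFrame ν.toMeasure a m) (h' : IsFrame ν.toMeasure a m') :
    UnorderedTuple.mk (fun i => axis d a ν (m i)) =
      UnorderedTuple.mk (fun i => axis d a ν (m' i)) := by
  obtain ⟨σ, hσ⟩ := h.exists_perm hV ha ha' ha'' h'
  exact Quotient.sound ⟨σ, funext fun i =>
    axis_eq_of_close hV ha ha' ha'' h (h'.2 i) (h.2 _) (hσ i)⟩

end Axis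

/-! ### Equivariance -/

section Equivariance

variable {V₁ V₂ : Type*}
  [NormedAddCommGroup V₁] [InnerProductSpace ℝ V₁]
  [NormedAddCommGroup V₂] [InnerProductSpace ℝ V₂]

theorem preimage_halfSpace (F : V₁ ≃ₗᵢ[ℝ] V₂) (n : V₁) :
    F ⁻¹' halfSpace (F n) = halfSpace n := by
  ext y
  simp [halfSpace]

variable [FiniteDimensional ℝ V₁] [MeasurableSpace V₁] [BorelSpace V₁]
  [FiniteDimensional ℝ V₂] [MeasurableSpace V₂] [BorelSpace V₂]

theorem NiceMeasure.map_measureReal (F : V₁ ≃ₗᵢ[ℝ] V₂) (ν : NiceMeasure V₁) {s : Set V₂}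
    (hs : MeasurableSet s) : (ν.map F).toMeasure.real s = ν.toMeasure.real (F ⁻¹' s) :=
  map_measureReal_apply F.continuous.measurable hs

theorem NiceMeasure.map_measureReal_halfSpace (F : V₁ ≃ₗᵢ[ℝ] V₂) (ν : NiceMeasure V₁) (n : V₁) :
    (ν.map F).toMeasure.real (halfSpace (F n)) = ν.toMeasure.real (halfSpace n) := by
  rw [ν.map_measureReal F (measurableSet_halfSpace _), preimage_halfSpace]

theorem IsFrame.map {d : ℕ} {a : ℝ} (F : V₁ ≃ₗᵢ[ℝ] V₂) {ν : NiceMeasure V₁}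
    {m : Fin (d + 1) → V₁} (h : IsFrame ν.toMeasure a m) :
    IsFrame (ν.map F).toMeasure a (F ∘ m) := by
  refine ⟨fun v hv => ?_, fun i => ?_⟩
  · obtain ⟨i, hi⟩ := h.1 (F.symm v) (by simpa using hv)
    refine ⟨i, ?_⟩
    rwa [← F.inner_map_map, F.apply_symm_apply] at hi
  · rw [light, Set.mem_ofPred_eq, Function.comp_apply, ν.map_measureReal_halfSpace F]
    exact h.2 i

theorem axis_map (d : ℕ) (a : ℝ) (F : V₁ ≃ₗᵢ[ℝ] V₂) (ν : NiceMeasure V₁) (p : V₁) :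
    axis d a (ν.map F) (F p) = F (axis d a ν p) := by
  have hw : ∀ n, weight d a (ν.map F) (F p) (F n) = weight d a ν p n := fun n => by
    rw [weight, weight, ν.map_measureReal_halfSpace F, ν.map_measureReal F
      ((measurableSet_halfSpace _).inter (measurableSet_halfSpace _)), Set.preimage_inter,
      preimage_halfSpace, preimage_halfSpace]
  have hball : F ⁻¹' Metric.ball (0 : V₂) 1 = Metric.ball (0 : V₁) 1 := by
    ext; simp
  rw [axis, axis, ← F.measurePreserving.setIntegral_preimage_emb
    F.toHomeomorph.measurableEmbedding, hball]
  simp only [hw, ← map_smul]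
  exact F.toContinuousLinearEquiv.integral_comp_comm _

end Equivariance

/-- The unordered tuple of the axes of a centred nice measure. -/
def axes {V : Type*} [NormedAddCommGroup V] [InnerProductSpace ℝ V] [FiniteDimensional ℝ V]
    [MeasurableSpace V] [BorelSpace V] {d : ℕ} {a : ℝ} {ν : NiceMeasure V}
    (h : ∃ m : Fin (d + 1) → V, IsFrame ν.toMeasure a m) : UnorderedTuple V (d + 1) :=
  UnorderedTuple.mk fun i => axis d a ν (h.choose i)

/-- The decisive bound is `(3 d + 2) a < 3`: with `D = d + 1`, it follows from `(3 D - 1)(3 D² + 1)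
≤ 9 D³`, and it implies the two after it. -/
theorem bounds_of_mem_Ioo_a₀ {d : ℕ} {a : ℝ} (ha : a ∈ Set.Ioo (1 / ((d : ℝ) + 1)) (a₀ d)) :
    1 < ((d : ℝ) + 1) * a ∧ (3 * (d : ℝ) + 2) * a < 3 ∧ (d : ℝ) * a < 1 ∧
      (2 * (d : ℝ) + 1) * a < 2 := by
  have hd : (0 : ℝ) ≤ d := Nat.cast_nonneg d
  have hd1 : (0 : ℝ) < (d : ℝ) + 1 := by linarith
  have h1 : 1 < ((d : ℝ) + 1) * a := (div_lt_iff₀' hd1).1 ha.1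
  have h2 : a * (3 * ((d : ℝ) + 1) ^ 3) < 3 * ((d : ℝ) + 1) ^ 2 + 1 := by
    have : a₀ d = (3 * ((d : ℝ) + 1) ^ 2 + 1) / (3 * ((d : ℝ) + 1) ^ 3) := by
      rw [a₀]
      field_simp
    rw [← lt_div_iff₀ (by positivity), ← this]
    exact ha.2
  have ha0 : 0 < a := by
    by_contra! h
    nlinarith
  have h3 : (3 * (d : ℝ) + 2) * a < 3 := by
    have hlt : (3 * (d : ℝ) + 2) * a * (3 * ((d : ℝ) + 1) ^ 3) < 3 * (3 * ((d : ℝ) + 1) ^ 3) := by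
      calc _ = (3 * (d : ℝ) + 2) * (a * (3 * ((d : ℝ) + 1) ^ 3)) := by ring
        _ < (3 * (d : ℝ) + 2) * (3 * ((d : ℝ) + 1) ^ 2 + 1) := by gcongr
        _ ≤ _ := by nlinarith
    exact lt_of_mul_lt_mul_right hlt (by positivity)
  refine ⟨h1, h3, ?_, ?_⟩ <;> nlinarith

end TukeyDepth

end

/-! ### Continuity and equivariance of the tuple of axes -/

open TukeyDepth

theorem lemma2p3 (d : ℕ) (a : ℝ) (ha : a ∈ Set.Ioo (1 / ((d : ℝ) + 1)) (TukeyDepth.a₀ d)) :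
    ∃ T : ∀ (V : Type u) [NormedAddCommGroup V] [InnerProductSpace ℝ V] [FiniteDimensional ℝ V]
        [MeasurableSpace V] [BorelSpace V], Module.finrank ℝ V = d →
        TukeyDepth.NiceMeasure.centred V a → TukeyDepth.simplexTuples V d,
      (∀ (V : Type u) [NormedAddCommGroup V] [InnerProductSpace ℝ V] [FiniteDimensional ℝ V]
        [MeasurableSpace V] [BorelSpace V] (hV : Module.finrank ℝ V = d),
        Continuous (T V hV)) ∧
      (∀ (V₁ V₂ : Type u)
        [NormedAddCommGroup V₁] [InnerProductSpace ℝ V₁] [FiniteDimensional ℝ V₁]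
        [MeasurableSpace V₁] [BorelSpace V₁]
        [NormedAddCommGroup V₂] [InnerProductSpace ℝ V₂] [FiniteDimensional ℝ V₂]
        [MeasurableSpace V₂] [BorelSpace V₂]
        (hV₁ : Module.finrank ℝ V₁ = d) (hV₂ : Module.finrank ℝ V₂ = d) (F : V₁ ≃ₗᵢ[ℝ] V₂)
        (ν : TukeyDepth.NiceMeasure.centred V₁ a),
        T V₂ hV₂ (TukeyDepth.NiceMeasure.mapCentred a F ν) =
          TukeyDepth.simplexTuplesMap d F (T V₁ hV₁ ν)) := by
  obtain ⟨ha1, ha3, ha', ha2⟩ := bounds_of_mem_Ioo_a₀ ha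
  refine ⟨fun V _ _ _ _ _ hV ν => ⟨axes (ν.1.exists_isFrame hV ha3 ha' ha1 ν.2),
    (IsFrame.posSpanning_axis hV ha3 ha' ha2
      (ν.1.exists_isFrame hV ha3 ha' ha1 ν.2).choose_spec).mk_mem_simplexTuples hV⟩, ?_, ?_⟩
  · intro V _ _ _ _ _ hV
    refine Continuous.subtype_mk (continuous_iff_continuousAt.2 fun ν => ?_) _
    -- Positive spanning does not involve the measure and lightness of a fixed normal is an open
    -- condition. Hence this one frame computes the map throughout a neighbourhood of `ν`.
    obtain ⟨m, hm⟩ := ν.1.exists_isFrame hV ha3 ha' ha1 ν.2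
    have hcont : Continuous fun ν' : NiceMeasure.centred V a =>
        UnorderedTuple.mk fun i => axis d a ν'.1 (m i) :=
      continuous_quotient_mk'.comp (continuous_pi fun i =>
        (continuous_axis (m i)).comp continuous_subtype_val)
    refine hcont.continuousAt.congr ?_
    have hev : ∀ᶠ ν' : NiceMeasure.centred V a in nhds ν,
        ∀ i, m i ∈ light ν'.1.toMeasure a :=
      Filter.eventually_all.2 fun i =>
        ((NiceMeasure.continuous_measureReal (measurableSet_halfSpace (m i))).comp
          continuous_subtype_val).continuousAt.eventually_lt continuousAt_const (hm.2 i)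
    filter_upwards [hev] with ν' hν'
    exact mk_axis_eq hV ha3 ha' ha2 ⟨hm.1, hν'⟩
      (ν'.1.exists_isFrame hV ha3 ha' ha1 ν'.2).choose_spec
  · intro V₁ V₂ _ _ _ _ _ _ _ _ _ _ hV₁ hV₂ F ν
    apply Subtype.ext
    have h₁ := (ν.1.exists_isFrame hV₁ ha3 ha' ha1 ν.2).choose_spec
    have h₂ := ((NiceMeasure.mapCentred a F ν).1.exists_isFrame hV₂ ha3 ha' ha1
      (NiceMeasure.mapCentred a F ν).2).choose_spec
    -- The frame chosen for the push-forward need not be the image of the one chosen for `ν`, but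
    -- both give the same unordered axes.
    refine (mk_axis_eq hV₂ ha3 ha' ha2 h₂ (h₁.map F)).trans ?_
    exact congrArg UnorderedTuple.mk (funext fun i => axis_map d a F ν.1 _)
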